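/- Let $D$ be a finite digraph with vertex set $V(D)=\{v_1,\dots,v_n\}$ and arc set $A(D)\subseteq V(D)\times V(D)$ (so there are no parallel arcs; loops are allowed, but need not occur). For an arc $e=(u,v)$ write $t(e)=u$ for its tail and $h(e)=v$ for its head, and put $d_+(v)=|\{e\in A(D): t(e)=v\}|$ and $d_-(v)=|\{e\in A(D): h(e)=v\}|$. The middle digraph $M(D)$ is the digraph with vertex set $V(D)\sqcup A(D)$ whose arcs are $(t(e),e)$ and $(e,h(e))$ for every $e\in A(D)$, and $(e,f)$ for all $e,f\in A(D)$ with $h(e)=t(f)$. A spanning tree of a digraph is a (weakly) connected subdigraph that contains all vertices and has no directed cycles, in which one vertex (the root) has outdegree $0$ and every other vertex has outdegree $1$. Let $t(\cdot)$ denote the number of spanning trees of a digraph, over all possible roots. Then $$t(M(D)) = t(D)\prod_{i=1}^{n}\bigl(1+d_+(v_i)\bigr)^{d_-(v_i)}.$$ -/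

import Mathlib

namespace Digraph

/-- The arcs of `D`: the ordered pairs of adjacent vertices. Since `Digraph V` is a relation on `V`,
there are no parallel arcs. -/
def Arc {V : Type*} (D : Digraph V) : Type _ :=
  {e : V × V // D.Adj e.1 e.2}

/-- The tail `u` of an arc `(u, v)`. -/
def Arc.tail {V : Type*} {D : Digraph V} (e : D.Arc) : V := e.1.1

/-- The head `v` of an arc `(u, v)`. -/
def Arc.head {V : Type*} {D : Digraph V} (e : D.Arc) : V := e.1.2

/-- The outdegree of `v`: the number of arcs with tail `v`. -/
noncomputable def outDegree {V : Type*} (D : Digraph V) (v : V) : ℕ :=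
  {e : D.Arc | e.tail = v}.ncard

/-- The indegree of `v`: the number of arcs with head `v`. -/
noncomputable def inDegree {V : Type*} (D : Digraph V) (v : V) : ℕ :=
  {e : D.Arc | e.head = v}.ncard

/-- `T` is a spanning tree of `D`: a subdigraph of `D` containing all vertices, (weakly) connected,
without directed cycles (of any length, loops included), in which one vertex, the root, has
outdegree 0 and every other vertex has outdegree 1. -/
structure IsSpanningTree {V : Type*} (D T : Digraph V) : Prop where
  le : T ≤ D
  connected : T.toSimpleGraphInclusive.Connected
  acyclic : ∀ v, ¬ Relation.TransGen T.Adj v v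
  exists_root : ∃ u, T.outDegree u = 0 ∧ ∀ v, v ≠ u → T.outDegree v = 1

/-- The number of spanning trees of `D` (over all roots). -/
noncomputable def numSpanningTrees {V : Type*} (D : Digraph V) : ℕ :=
  {T : Digraph V | D.IsSpanningTree T}.ncard

/-- The middle digraph of `D`: its vertices are the vertices and the arcs of `D`; every arc `e` of
`D` is replaced by the directed path `tail e → e → head e`, and there is an arc `e → f` whenever
the head of `e` is the tail of `f`. -/
def middle {V : Type*} (D : Digraph V) : Digraph (V ⊕ D.Arc) where
  Adj
    | .inl _, .inl _ => False
    | .inl v, .inr e => e.tail = v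
    | .inr e, .inl v => e.head = v
    | .inr e, .inr f => e.head = f.tail

end Digraph

open Relation

namespace Digraph

section OutDegree

variable {V : Type*} (D : Digraph V)

/-! Adding the all-ones vector to one column `r` of the Laplacian gives a matrix whose determinant
counts spanning trees over all roots at once (`det_rootedLaplacian`). Its row at `v` is the sum of
`e_v - e_w` over out-neighbours `w`, plus `e_r`, so multilinearity expands the determinant over
partial functions `c`, with `none` selecting `e_r`. By `det_choiceRow` each term is 1 if `c` is a
spanning tree and 0 otherwise.

For the middle digraph this matrix splits into block factors: one contributes the product of `1 +
outDegree` over heads of arcs, the other has as Schur complement the corresponding matrix of `D`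
(`det_rootedLaplacian_middle`). -/

theorem outDegree_eq_ncard (v : V) : D.outDegree v = {w | D.Adj v w}.ncard := by
  refine Set.ncard_congr (fun e _ => e.head) ?_ ?_ ?_
  · rintro ⟨⟨a, b⟩, h⟩ rfl
    exact h
  · rintro ⟨⟨a, b⟩, h⟩ ⟨⟨a', b'⟩, h'⟩ ha ha' hb
    simp only [Arc.tail, Arc.head] at ha ha' hb
    subst ha hb
    subst ha'
    rfl
  · intro w hw
    exact ⟨⟨(v, w), hw⟩, rfl, rfl⟩

theorem outDegree_eq_sum [Fintype V] [DecidableRel D.Adj] (v : V) :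
    (D.outDegree v : ℤ) = ∑ w, if D.Adj v w then 1 else 0 := by
  rw [outDegree_eq_ncard, Set.ncard_eq_toFinset_card']
  simp

end OutDegree

/-! ### Spanning trees as partial functions -/

section Choice

variable {V : Type*}

/-- The digraph in which `v` has the single out-neighbour `w` if `c v = some w`, and no
out-neighbour if `c v = none`. -/
def ofChoice (c : V → Option V) : Digraph V where
  Adj v w := c v = some w

theorem ofChoice_adj {c : V → Option V} {v w : V} : (ofChoice c).Adj v w ↔ c v = some w := Iff.rfl

theorem ofChoice_injective : Function.Injective (ofChoice : (V → Option V) → Digraph V) := by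
  intro c c' h
  funext v
  ext w
  rw [← ofChoice_adj, h, ofChoice_adj]

theorem outDegree_ofChoice_of_eq_none {c : V → Option V} {v : V} (h : c v = none) :
    (ofChoice c).outDegree v = 0 := by
  simp [outDegree_eq_ncard, ofChoice_adj, h]

theorem outDegree_ofChoice_of_ne_none {c : V → Option V} {v : V} (h : c v ≠ none) :
    (ofChoice c).outDegree v = 1 := by
  obtain ⟨w, hw⟩ := Option.ne_none_iff_exists'.1 h
  simp [outDegree_eq_ncard, ofChoice_adj, hw]

theorem IsSpanningTree.exists_ofChoice_eq [Finite V] {D T : Digraph V} (hT : D.IsSpanningTree T) :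
    ∃ c, ofChoice c = T := by
  classical
  have huniq : ∀ v w w', T.Adj v w → T.Adj v w' → w = w' := by
    intro v w w' hw hw'
    obtain ⟨u, hu, hu'⟩ := hT.exists_root
    have hle : {w | T.Adj v w}.ncard ≤ 1 := by
      rw [← outDegree_eq_ncard]
      by_cases hv : v = u
      · rw [hv, hu]; exact zero_le_one
      · exact (hu' v hv).le
    exact (Set.ncard_le_one (Set.toFinite _)).1 hle w hw w' hw'
  refine ⟨fun v => if h : ∃ w, T.Adj v w then some h.choose else none, ?_⟩
  ext v w
  rw [ofChoice_adj]
  by_cases h : ∃ w, T.Adj v w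
  · simp only [dif_pos h, Option.some.injEq]
    exact ⟨fun hw => hw ▸ h.choose_spec, fun hw => huniq v _ _ h.choose_spec hw⟩
  · simp only [dif_neg h, reduceCtorEq, false_iff]
    exact fun hw => h ⟨w, hw⟩

theorem IsSpanningTree.existsUnique_eq_none {D : Digraph V} {c : V → Option V}
    (hT : D.IsSpanningTree (ofChoice c)) : ∃ s, ∀ v, c v = none ↔ v = s := by
  obtain ⟨u, hu, hu'⟩ := hT.exists_root
  refine ⟨u, fun v => ⟨fun hv => ?_, ?_⟩⟩
  · by_contra hne
    have h1 := hu' v hne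
    rw [outDegree_ofChoice_of_eq_none hv] at h1
    exact zero_ne_one h1
  · rintro rfl
    by_contra hne
    rw [outDegree_ofChoice_of_ne_none hne] at hu
    exact one_ne_zero hu

theorem isSpanningTree_ofChoice {D : Digraph V} {c : V → Option V} {s : V}
    (hc : ∀ v w, c v = some w → D.Adj v w) (hs : ∀ v, c v = none ↔ v = s)
    (hreach : ∀ v, ReflTransGen (ofChoice c).Adj v s) : D.IsSpanningTree (ofChoice c) where
  le v w h := hc v w h
  connected := by
    have hr : ∀ v, (ofChoice c).toSimpleGraphInclusive.Reachable v s := by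
      intro v
      induction hreach v using ReflTransGen.head_induction_on with
      | refl => exact SimpleGraph.Reachable.refl _
      | @head a b hab _ ih =>
        by_cases hne : a = b
        · exact hne ▸ ih
        · refine SimpleGraph.Reachable.trans (SimpleGraph.Adj.reachable ?_) ih
          exact (SimpleGraph.fromRel_adj _ _ _).2 ⟨hne, Or.inl hab⟩
    have : Nonempty V := ⟨s⟩
    exact ⟨fun v w => (hr v).trans (hr w).symm⟩
  acyclic v hv := by
    have hcyc : TransGen (ofChoice c).Adj s s := by
      -- Out-neighbours are unique, so a cycle at `v` passes through every vertex reachable from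
      -- `v`, hence through the sink `s`.
      have key : ∀ w, ReflTransGen (ofChoice c).Adj v w → TransGen (ofChoice c).Adj w w := by
        intro w hw
        induction hw with
        | refl => exact hv
        | @tail a b _ hab ih =>
          obtain ⟨b', hab', hb'⟩ := TransGen.head'_iff.1 ih
          rw [ofChoice_adj] at hab hab'
          obtain rfl : b = b' := Option.some.inj (hab.symm.trans hab')
          exact TransGen.tail' hb' hab
      exact key s (hreach v)
    obtain ⟨b, hb, -⟩ := TransGen.head'_iff.1 hcyc
    rw [ofChoice_adj, (hs s).2 rfl] at hb
    cases hb
  exists_root := ⟨s, outDegree_ofChoice_of_eq_none ((hs s).2 rfl), fun v hv =>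
    outDegree_ofChoice_of_ne_none fun h => hv ((hs v).1 h)⟩

end Choice

/-! ### The matrix-tree theorem over all roots -/

section MatrixTree

open Matrix

variable {V : Type*} [Fintype V] [DecidableEq V]

/-- The identity matrix minus the transition matrix of the partial function `c`. -/
def choiceMatrix (c : V → Option V) : Matrix V V ℤ :=
  of fun v => Pi.single v 1 - (c v).elim 0 fun w => Pi.single w 1

/-- The row that the choice `o` of an out-neighbour of `v` contributes to the Laplacian to whose
column `r` the all-ones vector is added; `none` stands for the choice of that all-ones vector. -/
def choiceRow (r v : V) (o : Option V) : V → ℤ :=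
  o.elim (Pi.single r 1) fun w => Pi.single v 1 - Pi.single w 1

theorem det_eq_zero_of_row_sum_eq_zero [Nonempty V] {M : Matrix V V ℤ}
    (h : ∀ v, ∑ w, M v w = 0) : M.det = 0 := by
  refine exists_mulVec_eq_zero_iff.1 ⟨1, one_ne_zero, ?_⟩
  funext v
  simp [mulVec, dotProduct, h]

theorem sum_choiceRow_some (r v w : V) : ∑ x, choiceRow r v (some w) x = 0 := by
  simp [choiceRow, Finset.sum_sub_distrib]

theorem det_choiceRow_of_forall_ne_none (r : V) {c : V → Option V} (hc : ∀ v, c v ≠ none) :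
    (of fun v => choiceRow r v (c v)).det = 0 := by
  have : Nonempty V := ⟨r⟩
  refine det_eq_zero_of_row_sum_eq_zero fun v => ?_
  obtain ⟨w, hw⟩ := Option.ne_none_iff_exists'.1 (hc v)
  simpa [hw] using sum_choiceRow_some r v w

/-- Replacing `e_r` by `e_s` in row `s` changes the determinant by that of a matrix with zero row
sums, so the result does not depend on `r`. -/
theorem det_choiceRow_of_unique_none (r s : V) {c : V → Option V} (hs : ∀ v, c v = none ↔ v = s) :
    (of fun v => choiceRow r v (c v)).det = (choiceMatrix c).det := by
  have : Nonempty V := ⟨r⟩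
  have hrow : ∀ v, v ≠ s → ∀ x, choiceRow r v (c v) x = choiceMatrix c v x := by
    intro v hv x
    obtain ⟨w, hw⟩ := Option.ne_none_iff_exists'.1 fun h => hv ((hs v).1 h)
    simp [choiceRow, choiceMatrix, hw]
  have h1 : (of fun v => choiceRow r v (c v)) = updateRow (choiceMatrix c) s
      (Pi.single s 1 + (Pi.single r 1 - Pi.single s 1)) := by
    ext v x
    by_cases hv : v = s
    · subst hv
      simp [choiceRow, (hs v).2 rfl]
    · simpa [updateRow_ne hv] using hrow v hv x
  have h2 : updateRow (choiceMatrix c) s (Pi.single s 1) = choiceMatrix c := by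
    conv_rhs => rw [← updateRow_eq_self (choiceMatrix c) s]
    congr 1
    funext x
    simp [choiceMatrix, (hs s).2 rfl]
  have h3 : (updateRow (choiceMatrix c) s (Pi.single r 1 - Pi.single s 1)).det = 0 := by
    refine det_eq_zero_of_row_sum_eq_zero fun v => ?_
    by_cases hv : v = s
    · subst hv
      simp [Finset.sum_sub_distrib]
    · simp only [updateRow_ne hv, ← hrow v hv]
      obtain ⟨w, hw⟩ := Option.ne_none_iff_exists'.1 fun h => hv ((hs v).1 h)
      rw [hw, sum_choiceRow_some]
  rw [h1, det_updateRow_add, h2, h3, add_zero]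

theorem det_choiceMatrix_of_acyclic {c : V → Option V}
    (hc : ∀ v, ¬ TransGen (ofChoice c).Adj v v) : (choiceMatrix c).det = 1 := by
  -- The number of vertices that reach `v` strictly increases along arcs, so ordering by it makes
  -- the matrix unitriangular.
  let b : V → ℕ := fun v => {w | ReflTransGen (ofChoice c).Adj w v}.ncard
  have hb : ∀ v w, c v = some w → b v < b w := by
    intro v w hvw
    refine Set.ncard_lt_ncard ?_ (Set.toFinite _)
    refine ⟨fun x hx => hx.tail hvw, fun h => ?_⟩
    exact hc w (TransGen.tail' (h ReflTransGen.refl) hvw)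
  have hentry : ∀ v w, b w ≤ b v → choiceMatrix c v w = (1 : Matrix V V ℤ) v w := by
    intro v w hvw
    rw [one_apply]
    cases hcv : c v with
    | none => simp [choiceMatrix, hcv, Pi.single_apply, eq_comm]
    | some x =>
      have hx : w ≠ x := by
        rintro rfl
        exact absurd (hb v w hcv) hvw.not_gt
      simp [choiceMatrix, hcv, Pi.single_apply, hx, eq_comm]
  have htri : BlockTriangular (choiceMatrix c) b := by
    intro v w hvw
    rw [hentry v w hvw.le, one_apply_ne]
    rintro rfl
    exact lt_irrefl _ hvw
  rw [htri.det]
  refine Finset.prod_eq_one fun k _ => ?_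
  have : (choiceMatrix c).toSquareBlock b k = 1 := by
    ext v w
    rw [toSquareBlock_def, of_apply, hentry _ _ (w.2.trans v.2.symm).le, one_apply, one_apply]
    simp [Subtype.ext_iff]
  rw [this, det_one]

theorem det_choiceMatrix_of_not_reach {c : V → Option V} {s v : V}
    (hs : ∀ v, c v = none ↔ v = s) (hv : ¬ ReflTransGen (ofChoice c).Adj v s) :
    (choiceMatrix c).det = 0 := by
  classical
  -- A kernel vector: reaching `s` is invariant along arcs, and the entry at `s` itself is 0.
  let x : V → ℤ := fun w => if ReflTransGen (ofChoice c).Adj w s then 0 else 1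
  refine exists_mulVec_eq_zero_iff.1 ⟨x, fun h => ?_, ?_⟩
  · have := congrFun h v
    simp [x, hv] at this
  · funext w
    cases hcw : c w with
    | none =>
      obtain rfl := (hs w).1 hcw
      simp [choiceMatrix, mulVec, hcw, x, ReflTransGen.refl]
    | some y =>
      have hiff : ReflTransGen (ofChoice c).Adj w s ↔ ReflTransGen (ofChoice c).Adj y s := by
        refine ⟨fun h => ?_, fun h => h.head hcw⟩
        obtain rfl | ⟨z, hz, hzs⟩ := ReflTransGen.cases_head h
        · rw [(hs w).2 rfl] at hcw
          cases hcw
        · rw [ofChoice_adj, hcw] at hz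
          exact Option.some.inj hz ▸ hzs
      have hrow : choiceMatrix c w = Pi.single w 1 - Pi.single y 1 := by
        funext z
        simp [choiceMatrix, hcw]
      have h : Pi.single w 1 ⬝ᵥ x - Pi.single y 1 ⬝ᵥ x = 0 := by simp [x, hiff]
      rw [← sub_dotProduct, ← hrow] at h
      exact h

open scoped Classical in
theorem det_choiceRow (D : Digraph V) (r : V) {c : V → Option V}
    (hc : ∀ v w, c v = some w → D.Adj v w) :
    (of fun v => choiceRow r v (c v)).det = if D.IsSpanningTree (ofChoice c) then 1 else 0 := by
  split_ifs with hT
  · obtain ⟨s, hs⟩ := hT.existsUnique_eq_none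
    rw [det_choiceRow_of_unique_none r s hs, det_choiceMatrix_of_acyclic hT.acyclic]
  · by_cases hnone : ∀ v, c v ≠ none
    · exact det_choiceRow_of_forall_ne_none r hnone
    push Not at hnone
    obtain ⟨s, hs⟩ := hnone
    by_cases hs' : ∀ v, c v = none → v = s
    · have hiff : ∀ v, c v = none ↔ v = s := fun v => ⟨hs' v, fun h => h ▸ hs⟩
      rw [det_choiceRow_of_unique_none r s hiff]
      by_contra hdet
      refine hT (isSpanningTree_ofChoice hc hiff fun v => ?_)
      by_contra hv
      exact hdet (det_choiceMatrix_of_not_reach hiff hv)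
    · push Not at hs'
      -- Two vertices without a choice give two rows equal to `e_r`.
      obtain ⟨v, hv, hvs⟩ := hs'
      refine det_zero_of_row_eq hvs ?_
      funext x
      simp [choiceRow, hv, hs]

/-- The Laplacian of `D` (outdegrees minus adjacency) with the all-ones vector added to
column `r`. -/
noncomputable def rootedLaplacian (D : Digraph V) [DecidableRel D.Adj] (r : V) : Matrix V V ℤ :=
  of fun v w => (if v = w then (D.outDegree v : ℤ) else 0) - (if D.Adj v w then 1 else 0) +
    if r = w then 1 else 0

/-- A form of the **matrix-tree theorem** that counts the spanning trees over all roots. -/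
theorem det_rootedLaplacian (D : Digraph V) [DecidableRel D.Adj] (r : V) :
    (D.rootedLaplacian r).det = D.numSpanningTrees := by
  classical
  let A : V → Finset (Option V) := fun v => Finset.univ.filter fun o => ∀ w, o = some w → D.Adj v w
  have hA : ∀ c : V → Option V,
      c ∈ Fintype.piFinset A ↔ ∀ v w, c v = some w → D.Adj v w := by
    simp [A, Fintype.mem_piFinset]
  have hrows : D.rootedLaplacian r = fun v => ∑ o ∈ A v, choiceRow r v o := by
    funext v
    funext w
    rw [Finset.sum_apply, Finset.sum_filter, Fintype.sum_option]
    have : ∀ x, (if ∀ w, some x = some w → D.Adj v w then choiceRow r v (some x) w else 0) =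
        (if v = w then if D.Adj v x then 1 else 0 else 0) -
          if w = x then if D.Adj v x then 1 else 0 else 0 := by
      intro x
      by_cases h1 : v = w <;> by_cases h2 : w = x <;> by_cases h3 : D.Adj v x <;>
        simp [choiceRow, Pi.single_apply, h1, h2, h3, eq_comm]
    simp only [this, Finset.sum_sub_distrib, rootedLaplacian, of_apply, outDegree_eq_sum]
    by_cases h1 : v = w <;> simp [choiceRow, Pi.single_apply, h1, eq_comm, add_comm]
  have hsum : (D.rootedLaplacian r).det =
      ∑ c ∈ Fintype.piFinset A, (of fun v => choiceRow r v (c v)).det := by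
    rw [hrows]
    exact (detRowAlternating : (V → ℤ) [⋀^V]→ₗ[ℤ] ℤ).toMultilinearMap.map_sum_finset
      (fun v o => choiceRow r v o) A
  rw [hsum, Finset.sum_congr rfl fun c hc => D.det_choiceRow r ((hA c).1 hc), Finset.sum_boole]
  congr 1
  rw [numSpanningTrees, ← Set.ncard_coe_finset, ← Set.ncard_image_of_injective _ ofChoice_injective]
  congr 1
  ext T
  simp only [Finset.coe_filter, Set.mem_image, Set.mem_ofPred_eq]
  constructor
  · rintro ⟨c, ⟨-, hc⟩, rfl⟩
    exact hc
  · intro hT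
    obtain ⟨c, rfl⟩ := hT.exists_ofChoice_eq
    exact ⟨c, ⟨(hA c).2 fun v w h => hT.le h, hT⟩, rfl⟩

end MatrixTree

/-! ### The middle digraph and its Laplacian -/

section Middle

variable {V : Type*} (D : Digraph V)

@[simp]
theorem middle_adj_inl_inl (v w : V) : ¬ D.middle.Adj (Sum.inl v) (Sum.inl w) := id

@[simp]
theorem middle_adj_inl_inr (v : V) (e : D.Arc) :
    D.middle.Adj (Sum.inl v) (Sum.inr e) ↔ e.tail = v := Iff.rfl

@[simp]
theorem middle_adj_inr_inl (e : D.Arc) (v : V) :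
    D.middle.Adj (Sum.inr e) (Sum.inl v) ↔ e.head = v := Iff.rfl

@[simp]
theorem middle_adj_inr_inr (e f : D.Arc) :
    D.middle.Adj (Sum.inr e) (Sum.inr f) ↔ e.head = f.tail := Iff.rfl

theorem outDegree_middle_inl (v : V) : D.middle.outDegree (Sum.inl v) = D.outDegree v := by
  have h : {x | D.middle.Adj (Sum.inl v) x} = Sum.inr '' {e : D.Arc | e.tail = v} := by
    ext (w | e) <;> simp
  rw [outDegree_eq_ncard, h, Set.ncard_image_of_injective _ Sum.inr_injective, outDegree]

theorem outDegree_middle_inr [Finite V] (e : D.Arc) :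
    D.middle.outDegree (Sum.inr e) = 1 + D.outDegree e.head := by
  have : Finite D.Arc := Subtype.finite
  have h : {x | D.middle.Adj (Sum.inr e) x} =
      {Sum.inl e.head} ∪ Sum.inr '' {f : D.Arc | f.tail = e.head} := by
    ext (w | f) <;> simp [eq_comm]
  rw [outDegree_eq_ncard, h, Set.ncard_union_eq (by simp) (Set.toFinite _) (Set.toFinite _),
    Set.ncard_singleton, Set.ncard_image_of_injective _ Sum.inr_injective, outDegree]

theorem prod_arc_head [Fintype V] [Fintype D.Arc] {M : Type*} [CommMonoid M] (f : V → M) :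
    ∏ e : D.Arc, f e.head = ∏ v, f v ^ D.inDegree v := by
  classical
  rw [← Finset.prod_fiberwise Finset.univ Arc.head]
  refine Finset.prod_congr rfl fun v _ => ?_
  rw [Finset.prod_congr rfl fun e he => by rw [(Finset.mem_filter.1 he).2], Finset.prod_const,
    inDegree, Set.ncard_eq_toFinset_card']
  simp

open Matrix

theorem sum_arc_tail_head [Fintype V] [Fintype D.Arc] [DecidableEq V] [DecidableRel D.Adj]
    (v w : V) : ∑ e : D.Arc, (if e.tail = v then if e.head = w then (1 : ℤ) else 0 else 0) =
      if D.Adj v w then 1 else 0 := by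
  split_ifs with h
  · obtain ⟨e, rfl, rfl⟩ : ∃ e : D.Arc, e.tail = v ∧ e.head = w := ⟨⟨(v, w), h⟩, rfl, rfl⟩
    rw [Finset.sum_eq_single e]
    · simp
    · intro f _ hne
      split_ifs with h1 h2
      · exact absurd (Subtype.ext (Prod.ext h1 h2)) hne
      · rfl
      · rfl
    · simp
  · refine Finset.sum_eq_zero fun e _ => ?_
    split_ifs with h1 h2
    · exact absurd (h1 ▸ h2 ▸ e.2) h
    · rfl
    · rfl

theorem det_rootedLaplacian_middle [Fintype V] [Fintype D.Arc] [DecidableEq V] [DecidableEq D.Arc]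
    [DecidableRel D.Adj] [DecidableRel D.middle.Adj] (r : V) :
    (D.middle.rootedLaplacian (Sum.inl r)).det =
      (∏ e : D.Arc, (1 + D.outDegree e.head : ℤ)) * (D.rootedLaplacian r).det := by
  let E : Matrix D.Arc D.Arc ℤ := diagonal fun e => 1 + D.outDegree e.head
  let H : Matrix D.Arc V ℤ := of fun e v => if e.head = v then 1 else 0
  let T : Matrix V D.Arc ℤ := of fun v e => if e.tail = v then 1 else 0
  let R : Matrix V V ℤ :=
    of fun v w => (if v = w then (D.outDegree v : ℤ) else 0) + if r = w then 1 else 0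
  have hH : ∀ {W : Type _} (M : Matrix V W ℤ) (e : D.Arc) (w : W),
      (H * M) e w = M e.head w := by
    intro W M e w
    simp [H, mul_apply]
  -- An arc `e` has the same out-neighbours as its head, plus the head itself; subtracting the row
  -- of `head e` from that of `e` leaves only `H` and `E` terms.
  have hfac : D.middle.rootedLaplacian (Sum.inl r) =
      fromBlocks 1 0 H E * fromBlocks R (-T) (-H) 1 := by
    rw [fromBlocks_multiply]
    ext (v | e) (w | f)
    · simp [rootedLaplacian, R, outDegree_middle_inl]
    · simp [rootedLaplacian, T]
    · rw [fromBlocks_apply₂₁, Matrix.add_apply, hH, Matrix.mul_neg, Matrix.neg_apply, diagonal_mul]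
      simp only [rootedLaplacian, of_apply, R, H, reduceCtorEq, if_false, Sum.inl.injEq,
        middle_adj_inr_inl]
      split_ifs <;> simp_all <;> ring
    · rw [fromBlocks_apply₂₂, Matrix.add_apply, hH, Matrix.mul_one]
      simp only [rootedLaplacian, of_apply, Matrix.neg_apply, T, E, reduceCtorEq, if_false,
        Sum.inr.injEq, middle_adj_inr_inr, diagonal_apply, outDegree_middle_inr,
        eq_comm (a := f.tail)]
      push_cast
      ring
  -- `T * H` is the adjacency matrix of `D`, as there are no parallel arcs.
  have hred : R - (-T) * (-H) = D.rootedLaplacian r := by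
    rw [Matrix.neg_mul, Matrix.mul_neg, neg_neg]
    ext v w
    simp only [Matrix.sub_apply, mul_apply, of_apply, R, T, H, rootedLaplacian, ite_mul, one_mul,
      zero_mul, sum_arc_tail_head]
    ring
  rw [hfac, det_mul, det_fromBlocks_zero₁₂, det_one, one_mul, det_diagonal, det_fromBlocks_one₂₂,
    hred]

end Middle

end Digraph

theorem mainTheorem3 {V : Type*} [Fintype V] (D : Digraph V) :
    D.middle.numSpanningTrees =
      D.numSpanningTrees * ∏ v : V, (1 + D.outDegree v) ^ D.inDegree v := by
  classical
  let _ : Fintype D.Arc := Subtype.fintype _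
  cases isEmpty_or_nonempty V with
  -- Without vertices there is no column `r`; both counts vanish because connectedness requires a
  -- vertex.
  | inl hV =>
    have h0 : ∀ {W : Type _} [IsEmpty W] (G : Digraph W), G.numSpanningTrees = 0 := by
      intro W _ G
      have h : {T | G.IsSpanningTree T} = ∅ := Set.eq_empty_of_forall_notMem fun T hT =>
        not_isEmpty_iff.2 hT.connected.nonempty inferInstance
      rw [Digraph.numSpanningTrees, h, Set.ncard_empty]
    have : IsEmpty D.Arc := ⟨fun e => hV.elim e.tail⟩
    rw [h0, h0, zero_mul]
  | inr hV =>
    obtain ⟨r⟩ := hV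
    have h := D.det_rootedLaplacian_middle r
    rw [Digraph.det_rootedLaplacian, Digraph.det_rootedLaplacian] at h
    rw [mul_comm, ← D.prod_arc_head fun v => 1 + D.outDegree v]
    exact_mod_cast h
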